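/- Let $R$ be an associative ring with identity, $M$ an $R$-$R$-bimodule and $\theta: M\otimes_R M\to M$ an associative homomorphism of $R$-$R$-bimodules. Let $T=R\ltimes_\theta M$ be the $\theta$-extension, that is, the ring with underlying group $R\oplus M$ and multiplication $(r,m)(r',m')=(rr',\,rm'+mr'+\theta(m\otimes m'))$. All modules are unitary left modules. A $T$-module is identified with a pair $(X,\alpha)$, where $X$ is an $R$-module and $\alpha: M\otimes_R X\to X$ is an $R$-homomorphism with $\alpha\circ(1_M\otimes\alpha)=\alpha\circ(\theta\otimes 1_X)$; here $(r,m)x=rx+\alpha(m\otimes x)$. For an $R$-module $P$, let $l(P)=T\otimes_R P$, which is the pair $\left(P\oplus (M\otimes_R P),\begin{pmatrix}0&0\\1&\theta\otimes 1_P\end{pmatrix}\right)$. Let $q=R\otimes_T-:\operatorname{Mod}T\to\operatorname{Mod}R$, so that $q(X,\alpha)=\operatorname{Coker}(\alpha)$ and $q$ sends a $T$-homomorphism to the induced map on cokernels; in particular $q(l(P))\cong P$ naturally. For a homomorphism $\sigma:Q_1\to Q_0$ of modules over a ring $S$, let $\mathcal D_\sigma$ be the class of the $S$-modules $L$ such that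 $\operatorname{Hom}_S(\sigma,L):\operatorname{Hom}_S(Q_0,L)\to\operatorname{Hom}_S(Q_1,L)$ is surjective, and let $\operatorname{Gen}(Y)$ be the class of the quotients of coproducts of copies of an $S$-module $Y$. Let $\sigma$ be the first map of a projective presentation $Q_1\xrightarrow{\sigma}Q_0\to Y\to 0$ of $Y$ (an exact sequence with $Q_1$, $Q_0$ projective). Then $Y$ is called partial silting with respect to $\sigma$ if $Y\in\mathcal D_\sigma$ and $\mathcal D_\sigma$ is a torsion class (closed under epimorphic images, extensions and coproducts), and silting with respect to $\sigma$ if $\operatorname{Gen}(Y)=\mathcal D_\sigma$. **Proposition 4.3.** Let $P_1,P_0$ be $R$-modules and let $l(P_1)\xrightarrow{\delta}l(P_0)\to(X,\alpha)\to 0$ be a projective presentation of a $T$-module $(X,\alpha)$. 1. If $(X,\alpha)$ is silting with respect to $\delta$, then $\operatorname{Coker}(\alpha)$ is a silting $R$-module with respect to $q(\delta)$. 2. If $(X,\alpha)$ is partial silting with respect to $\delta$, then $\operatorname{Coker}(\alpha)$ is a partial silting $R$-module with respect to $q(\delta)$. In particular, $q(\delta)$ is in both cases the first map of a projective presentation of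 $\operatorname{Coker}(\alpha)$. -/

import Mathlib

universe u

set_option linter.unusedSectionVars false

/-! ## Silting modules over a (not necessarily commutative) ring -/

namespace Silting

section

variable {R : Type u} [Ring R]
variable {P₁ P₀ X : Type u} [AddCommGroup P₁] [Module R P₁] [AddCommGroup P₀] [Module R P₀]
  [AddCommGroup X] [Module R X]

/-- The class `𝒟_σ` of the left `R`-modules `L` such that
`Hom(σ, L) : Hom(P₀, L) → Hom(P₁, L)` is surjective. -/
def classD (σ : P₁ →ₗ[R] P₀) : ModuleCat.{u} R → Prop := fun L =>
  Function.Surjective (fun g : P₀ →ₗ[R] L => g ∘ₗ σ)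

variable (R X) in
/-- The class `Gen(X)` of the quotients of coproducts of copies of `X`. -/
def classGen : ModuleCat.{u} R → Prop := fun L =>
  ∃ (J : Type u) (f : (J →₀ X) →ₗ[R] L), Function.Surjective f

/-- A class of modules is a torsion class if it is closed under epimorphic images, extensions
and arbitrary coproducts. -/
structure IsTorsionClass (C : ModuleCat.{u} R → Prop) : Prop where
  of_surjective : ∀ (A B : ModuleCat.{u} R) (f : A →ₗ[R] B), Function.Surjective f → C A → C B
  of_extension : ∀ (A E B : ModuleCat.{u} R) (f : A →ₗ[R] E) (g : E →ₗ[R] B),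
    Function.Injective f → Function.Exact f g → Function.Surjective g → C A → C B → C E
  of_coproduct : ∀ (J : Type u) (Y : J → ModuleCat.{u} R), (∀ j, C (Y j)) →
    C (ModuleCat.of R (DirectSum J fun j => Y j))

/-- `P₁ --σ--> P₀ --π--> X --> 0` is a projective presentation of `X`. -/
structure IsProjectivePresentation (σ : P₁ →ₗ[R] P₀) (π : P₀ →ₗ[R] X) : Prop where
  projective₁ : Module.Projective R P₁
  projective₀ : Module.Projective R P₀
  exact : Function.Exact σ π
  surjective : Function.Surjective π

variable (X) in
/-- `X` is partial silting with respect to `σ`: the map `σ` is the first map of a projective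
presentation of `X`, `X` lies in `𝒟_σ`, and `𝒟_σ` is a torsion class. -/
structure IsPartialSilting (σ : P₁ →ₗ[R] P₀) : Prop where
  presentation : ∃ π : P₀ →ₗ[R] X, IsProjectivePresentation σ π
  mem : classD σ (ModuleCat.of R X)
  torsion : IsTorsionClass (classD σ)

variable (X) in
/-- `X` is silting with respect to `σ`: the map `σ` is the first map of a projective
presentation of `X`, and `Gen(X) = 𝒟_σ`. -/
structure IsSilting (σ : P₁ →ₗ[R] P₀) : Prop where
  presentation : ∃ π : P₀ →ₗ[R] X, IsProjectivePresentation σ π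
  gen_eq : classGen R X = classD σ

end

end Silting

/-! ## The tensor product over a noncommutative ring -/

section

variable (R : Type u) [Ring R]
variable (M : Type u) [AddCommGroup M] [Module R M] [Module Rᵐᵒᵖ M] [SMulCommClass R Rᵐᵒᵖ M]
variable (X : Type u) [AddCommGroup X] [Module R X]

open scoped TensorProduct

/-- The relations `(m r) ⊗ x = m ⊗ (r x)` in `M ⊗_ℤ X`. As the set of the generators is stable
under the left action of `R` on `M`, their `R`-span is the subgroup that they generate. -/
def balancedRelations : Submodule R (M ⊗[ℤ] X) :=
  Submodule.span R {t | ∃ (m : M) (r : R) (x : X),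
    t = (MulOpposite.op r • m) ⊗ₜ[ℤ] x - m ⊗ₜ[ℤ] (r • x)}

/-- The left `R`-module `M ⊗_R X`, for an `R`-`R`-bimodule `M` and a left `R`-module `X`. -/
abbrev BTensor : Type u := (M ⊗[ℤ] X) ⧸ balancedRelations R M X

variable {M X} in
/-- The pure tensor `m ⊗ x` in `M ⊗_R X`. -/
def btmul (m : M) (x : X) : BTensor R M X := Submodule.Quotient.mk (m ⊗ₜ[ℤ] x)

variable {R M X}

theorem btmul_add_left (m m' : M) (x : X) :
    btmul R (m + m') x = btmul R m x + btmul R m' x := by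
  simp [btmul, TensorProduct.add_tmul]

theorem btmul_add_right (m : M) (x x' : X) :
    btmul R m (x + x') = btmul R m x + btmul R m x' := by
  simp [btmul, TensorProduct.tmul_add]

theorem btmul_smul_left (r : R) (m : M) (x : X) :
    btmul R (r • m) x = r • btmul R m x := by
  simp only [btmul]
  rw [← Submodule.Quotient.mk_smul, TensorProduct.smul_tmul']

theorem btmul_balanced (m : M) (r : R) (x : X) :
    btmul R (MulOpposite.op r • m) x = btmul R m (r • x) := by
  simp only [btmul]
  rw [Submodule.Quotient.eq]
  exact Submodule.subset_span ⟨m, r, x, rfl⟩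

theorem btmul_zero_right (m : M) : btmul R m (0 : X) = 0 := by
  simp [btmul]

theorem btmul_zero_left (x : X) : btmul R (0 : M) x = 0 := by
  simp [btmul]

theorem BTensor.induction {p : BTensor R M X → Prop} (zero : p 0)
    (tmul : ∀ m x, p (btmul R m x)) (add : ∀ s t, p s → p t → p (s + t)) (t : BTensor R M X) :
    p t := by
  obtain ⟨t, rfl⟩ := Submodule.Quotient.mk_surjective _ t
  induction t using TensorProduct.induction_on with
  | zero => simpa using zero
  | tmul m x => exact tmul m x
  | add s t hs ht =>
    rw [Submodule.Quotient.mk_add]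
    exact add _ _ hs ht

/-- The universal property: a biadditive map that is `R`-linear in the first variable and
`R`-balanced induces an `R`-linear map on `M ⊗_R X`. -/
def BTensor.lift {Z : Type u} [AddCommGroup Z] [Module R Z] (f : M →+ X →+ Z)
    (hf : ∀ (r : R) m x, f (r • m) x = r • f m x)
    (hb : ∀ (m : M) (r : R) x, f (MulOpposite.op r • m) x = f m (r • x)) :
    BTensor R M X →ₗ[R] Z :=
  (balancedRelations R M X).liftQ
    { toFun := TensorProduct.liftAddHom f (by intro n m x; simp)
      map_add' := fun s t => map_add _ s t
      map_smul' := by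
        intro r t
        induction t using TensorProduct.induction_on with
        | zero => simp
        | tmul m x => simp [TensorProduct.smul_tmul', hf]
        | add s t hs ht => rw [smul_add, map_add, hs, ht, map_add, smul_add] }
    (by
      rw [balancedRelations, Submodule.span_le]
      rintro _ ⟨m, r, x, rfl⟩
      simp [hb])

theorem BTensor.lift_btmul {Z : Type u} [AddCommGroup Z] [Module R Z] (f : M →+ X →+ Z)
    (hf : ∀ (r : R) m x, f (r • m) x = r • f m x)
    (hb : ∀ (m : M) (r : R) x, f (MulOpposite.op r • m) x = f m (r • x)) (m : M) (x : X) :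
    BTensor.lift f hf hb (btmul R m x) = f m x := by
  simp [BTensor.lift, btmul]

end

/-! ## The `θ`-extension of a ring by a bimodule -/

section

variable (R : Type u) [Ring R]
variable (M : Type u) [AddCommGroup M] [Module R M] [Module Rᵐᵒᵖ M] [SMulCommClass R Rᵐᵒᵖ M]

/-- An associative homomorphism of `R`-`R`-bimodules `θ : M ⊗_R M → M`. The right action of `R` on
`M ⊗_R M` is the one on the second factor, so that right linearity and associativity
may be stated on tensors of elements, which generate. -/
structure AssocBimoduleHom where
  toLinearMap : BTensor R M M →ₗ[R] M
  map_right_smul : ∀ (m m' : M) (r : R),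
    toLinearMap (btmul R m (MulOpposite.op r • m')) =
      MulOpposite.op r • toLinearMap (btmul R m m')
  assoc : ∀ m m' m'' : M,
    toLinearMap (btmul R (toLinearMap (btmul R m m')) m'') =
      toLinearMap (btmul R m (toLinearMap (btmul R m' m'')))

variable {R M}

/-- The `θ`-extension `R ⋉_θ M`, with underlying additive group `R ⊕ M`. -/
@[ext] structure ThetaExt (_θ : AssocBimoduleHom R M) where
  fst : R
  snd : M

namespace ThetaExt

variable (θ : AssocBimoduleHom R M)

instance : Zero (ThetaExt θ) where
  zero := ⟨0, 0⟩

instance : Add (ThetaExt θ) where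
  add a b := ⟨a.fst + b.fst, a.snd + b.snd⟩

instance : Neg (ThetaExt θ) where
  neg a := ⟨-a.fst, -a.snd⟩

/-- `(r, m) (r', m') = (r r', r m' + m r' + θ(m ⊗ m'))`. -/
instance : Mul (ThetaExt θ) where
  mul a b := ⟨a.fst * b.fst,
    a.fst • b.snd + MulOpposite.op b.fst • a.snd + θ.toLinearMap (btmul R a.snd b.snd)⟩

instance : One (ThetaExt θ) where
  one := ⟨1, 0⟩

variable {θ}

theorem fst_add (a b : ThetaExt θ) : (a + b).1 = a.1 + b.1 := rfl
theorem snd_add (a b : ThetaExt θ) : (a + b).2 = a.2 + b.2 := rfl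
theorem fst_neg (a : ThetaExt θ) : (-a).1 = -a.1 := rfl
theorem snd_neg (a : ThetaExt θ) : (-a).2 = -a.2 := rfl
theorem fst_zero : (0 : ThetaExt θ).1 = 0 := rfl
theorem snd_zero : (0 : ThetaExt θ).2 = 0 := rfl
theorem fst_one : (1 : ThetaExt θ).1 = 1 := rfl
theorem snd_one : (1 : ThetaExt θ).2 = 0 := rfl
theorem fst_mul (a b : ThetaExt θ) : (a * b).1 = a.1 * b.1 := rfl
theorem snd_mul (a b : ThetaExt θ) : (a * b).2 =
    a.1 • b.2 + MulOpposite.op b.1 • a.2 + θ.toLinearMap (btmul R a.2 b.2) := rfl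

instance : Ring (ThetaExt θ) :=
  { (inferInstance : Zero (ThetaExt θ)), (inferInstance : Add (ThetaExt θ)),
    (inferInstance : Neg (ThetaExt θ)), (inferInstance : Mul (ThetaExt θ)),
    (inferInstance : One (ThetaExt θ)) with
    nsmul := nsmulRec
    zsmul := zsmulRec
    add_assoc := fun a b c => by
      apply ThetaExt.ext
      · simp only [fst_add, _root_.add_assoc]
      · simp only [snd_add, _root_.add_assoc]
    add_comm := fun a b => by
      apply ThetaExt.ext
      · exact _root_.add_comm _ _
      · exact _root_.add_comm _ _
    zero_add := fun a => by
      apply ThetaExt.ext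
      · simp only [fst_add, fst_zero, _root_.zero_add]
      · simp only [snd_add, snd_zero, _root_.zero_add]
    add_zero := fun a => by
      apply ThetaExt.ext
      · simp only [fst_add, fst_zero, _root_.add_zero]
      · simp only [snd_add, snd_zero, _root_.add_zero]
    neg_add_cancel := fun a => by
      apply ThetaExt.ext
      · simp only [fst_add, fst_zero, fst_neg, _root_.neg_add_cancel]
      · simp only [snd_add, snd_zero, snd_neg, _root_.neg_add_cancel]
    left_distrib := fun a b c => by
      apply ThetaExt.ext
      · simp only [fst_mul, fst_add, mul_add]
      · simp only [snd_mul, snd_add, fst_add, smul_add, MulOpposite.op_add, add_smul,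
          btmul_add_right, map_add]
        abel
    right_distrib := fun a b c => by
      apply ThetaExt.ext
      · simp only [fst_mul, fst_add, add_mul]
      · simp only [snd_mul, snd_add, fst_add, smul_add, add_smul, btmul_add_left, map_add]
        abel
    zero_mul := fun a => by
      apply ThetaExt.ext
      · simp only [fst_mul, fst_zero, zero_mul]
      · simp only [snd_mul, snd_zero, fst_zero, zero_smul, smul_zero, btmul_zero_left, map_zero,
          add_zero]
    mul_zero := fun a => by
      apply ThetaExt.ext
      · simp only [fst_mul, fst_zero, mul_zero]
      · simp only [snd_mul, snd_zero, fst_zero, MulOpposite.op_zero, zero_smul, smul_zero,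
          btmul_zero_right, map_zero, add_zero]
    mul_assoc := fun a b c => by
      apply ThetaExt.ext
      · simp only [fst_mul, mul_assoc]
      · simp only [snd_mul, fst_mul, smul_add, btmul_add_left, btmul_add_right, map_add, mul_smul,
          MulOpposite.op_mul, btmul_smul_left, map_smul, btmul_balanced, θ.map_right_smul, θ.assoc,
          smul_comm a.1 (MulOpposite.op c.1) b.2]
        abel
    one_mul := fun a => by
      apply ThetaExt.ext
      · simp only [fst_mul, fst_one, one_mul]
      · simp only [snd_mul, snd_one, fst_one, one_smul, smul_zero, btmul_zero_left, map_zero,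
          add_zero]
    mul_one := fun a => by
      apply ThetaExt.ext
      · simp only [fst_mul, fst_one, mul_one]
      · simp only [snd_mul, snd_one, fst_one, MulOpposite.op_one, one_smul, smul_zero,
          btmul_zero_right, map_zero, add_zero, zero_add] }

end ThetaExt

/-! ## Left modules over the `θ`-extension as pairs `(X, α)` -/

/-- A pair `(X, α)` of a left `R`-module `X` and an `R`-linear map `α : M ⊗_R X → X` with
`α ∘ (1 ⊗ α) = α ∘ (θ ⊗ 1)`. -/
structure ThetaModule (θ : AssocBimoduleHom R M) where
  carrier : Type u
  [addCommGroup : AddCommGroup carrier]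
  [module : Module R carrier]
  act : BTensor R M carrier →ₗ[R] carrier
  act_act : ∀ (m m' : M) (x : carrier),
    act (btmul R m (act (btmul R m' x))) = act (btmul R (θ.toLinearMap (btmul R m m')) x)

namespace ThetaModule

variable {θ : AssocBimoduleHom R M}

instance (X : ThetaModule θ) : AddCommGroup X.carrier := X.addCommGroup

instance (X : ThetaModule θ) : Module R X.carrier := X.module

/-- The left `R ⋉_θ M`-module given by a pair `(X, α)`: `(r, m) x = r x + α(m ⊗ x)`. -/
instance (X : ThetaModule θ) : SMul (ThetaExt θ) X.carrier where
  smul a x := a.fst • x + X.act (btmul R a.snd x)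

theorem smul_def (X : ThetaModule θ) (a : ThetaExt θ) (x : X.carrier) :
    a • x = a.fst • x + X.act (btmul R a.snd x) := rfl

instance (X : ThetaModule θ) : Module (ThetaExt θ) X.carrier where
  one_smul x := by
    simp only [smul_def, ThetaExt.fst_one, ThetaExt.snd_one, one_smul, btmul_zero_left, map_zero,
      add_zero]
  mul_smul a b x := by
    simp only [smul_def, ThetaExt.fst_mul, ThetaExt.snd_mul, mul_smul, smul_add, btmul_add_left,
      btmul_add_right, map_add, btmul_smul_left, map_smul, btmul_balanced, X.act_act]
    abel
  smul_zero a := by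
    simp only [smul_def, smul_zero, btmul_zero_right, map_zero, add_zero]
  smul_add a x y := by
    simp only [smul_def, smul_add, btmul_add_right, map_add]
    abel
  add_smul a b x := by
    simp only [smul_def, ThetaExt.fst_add, ThetaExt.snd_add, add_smul, btmul_add_left, map_add]
    abel
  zero_smul x := by
    simp only [smul_def, ThetaExt.fst_zero, ThetaExt.snd_zero, zero_smul, btmul_zero_left,
      map_zero, add_zero]

variable (θ) in
/-- The additive map `M ⊗_ℤ P → M ⊗_R P`, `m' ⊗ p ↦ θ(m ⊗ m') ⊗ p`, for a fixed `m`. -/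
def thetaTensorAux (P : Type u) [AddCommGroup P] [Module R P] (m : M) :
    TensorProduct ℤ M P →+ BTensor R M P :=
  TensorProduct.liftAddHom
    (AddMonoidHom.mk' (fun m' => AddMonoidHom.mk'
        (fun p => btmul R (θ.toLinearMap (btmul R m m')) p) (btmul_add_right _))
      (by intro a b; ext p; simp [btmul_add_right, btmul_add_left]))
    (by intro n m' p; simp only [map_zsmul, AddMonoidHom.zsmul_apply])

theorem thetaTensorAux_tmul (P : Type u) [AddCommGroup P] [Module R P] (m m' : M) (p : P) :
    thetaTensorAux θ P m (TensorProduct.tmul ℤ m' p) =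
      btmul R (θ.toLinearMap (btmul R m m')) p := rfl

theorem thetaTensorAux_smul (P : Type u) [AddCommGroup P] [Module R P] (m : M) (r : R)
    (t : TensorProduct ℤ M P) :
    thetaTensorAux θ P m (r • t) = thetaTensorAux θ P (MulOpposite.op r • m) t := by
  induction t using TensorProduct.induction_on with
  | zero => simp
  | tmul m' p => rw [TensorProduct.smul_tmul', thetaTensorAux_tmul, thetaTensorAux_tmul,
      btmul_balanced]
  | add s t hs ht => rw [smul_add, map_add, map_add, hs, ht]

theorem thetaTensorAux_eq_zero (P : Type u) [AddCommGroup P] [Module R P]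
    (t : TensorProduct ℤ M P) (ht : t ∈ balancedRelations R M P) :
    ∀ m, thetaTensorAux θ P m t = 0 := by
  refine Submodule.span_induction (p := fun t _ => ∀ m, thetaTensorAux θ P m t = 0)
    ?_ ?_ ?_ ?_ ht
  · rintro _ ⟨m', r, p, rfl⟩ m
    rw [map_sub, thetaTensorAux_tmul, thetaTensorAux_tmul, θ.map_right_smul, btmul_balanced,
      sub_self]
  · simp
  · intro s t _ _ hs ht m
    rw [map_add, hs, ht, add_zero]
  · intro r t _ ht m
    rw [thetaTensorAux_smul, ht]

variable (θ) in
/-- The map `θ ⊗ 1` with its first variable fixed: the additive map `M ⊗_R P → M ⊗_R P`,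
`m' ⊗ p ↦ θ(m ⊗ m') ⊗ p`. -/
def thetaTensor (P : Type u) [AddCommGroup P] [Module R P] (m : M) :
    BTensor R M P →+ BTensor R M P :=
  QuotientAddGroup.lift (balancedRelations R M P).toAddSubgroup (thetaTensorAux θ P m)
    (fun t ht => thetaTensorAux_eq_zero P t ht m)

theorem thetaTensor_btmul (P : Type u) [AddCommGroup P] [Module R P] (m m' : M) (p : P) :
    thetaTensor θ P m (btmul R m' p) = btmul R (θ.toLinearMap (btmul R m m')) p := rfl

theorem thetaTensor_add (P : Type u) [AddCommGroup P] [Module R P] (m n : M)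
    (w : BTensor R M P) :
    thetaTensor θ P (m + n) w = thetaTensor θ P m w + thetaTensor θ P n w := by
  induction w using BTensor.induction with
  | zero => simp
  | tmul m' p => simp only [thetaTensor_btmul, btmul_add_left, map_add]
  | add s t hs ht => rw [map_add, hs, ht, map_add, map_add]; abel

theorem thetaTensor_smul_left (P : Type u) [AddCommGroup P] [Module R P] (r : R) (m : M)
    (w : BTensor R M P) : thetaTensor θ P (r • m) w = r • thetaTensor θ P m w := by
  induction w using BTensor.induction with
  | zero => simp
  | tmul m' p => simp only [thetaTensor_btmul, btmul_smul_left, map_smul]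
  | add s t hs ht => rw [map_add, hs, ht, map_add, smul_add]

theorem thetaTensor_balanced (P : Type u) [AddCommGroup P] [Module R P] (m : M) (r : R)
    (w : BTensor R M P) :
    thetaTensor θ P (MulOpposite.op r • m) w = thetaTensor θ P m (r • w) := by
  induction w using BTensor.induction with
  | zero => simp
  | tmul m' p => rw [← btmul_smul_left]; simp only [thetaTensor_btmul, btmul_balanced]
  | add s t hs ht => rw [map_add, hs, ht, smul_add, map_add]

theorem thetaTensor_thetaTensor (P : Type u) [AddCommGroup P] [Module R P] (m n : M)
    (w : BTensor R M P) :
    thetaTensor θ P m (thetaTensor θ P n w) =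
      thetaTensor θ P (θ.toLinearMap (btmul R m n)) w := by
  induction w using BTensor.induction with
  | zero => simp
  | tmul m' p => simp only [thetaTensor_btmul, θ.assoc]
  | add s t hs ht => simp only [map_add, hs, ht]

variable (θ) in
/-- The structure map of `l(P)`, given by `m ⊗ (p, w) ↦ (0, m ⊗ p + (θ ⊗ 1)(m ⊗ w))`. -/
def freeAct (P : Type u) [AddCommGroup P] [Module R P] :
    BTensor R M (P × BTensor R M P) →ₗ[R] P × BTensor R M P :=
  BTensor.lift
    (AddMonoidHom.mk' (fun m => AddMonoidHom.mk'
        (fun y : P × BTensor R M P => ((0 : P), btmul R m y.1 + thetaTensor θ P m y.2))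
        (by
          intro y z
          simp only [Prod.fst_add, Prod.snd_add, btmul_add_right, map_add, Prod.mk_add_mk,
            add_zero]
          congr 1
          abel))
      (by
        intro m n
        ext y
        · simp
        · simp only [AddMonoidHom.mk'_apply, AddMonoidHom.add_apply, Prod.snd_add,
            btmul_add_left, thetaTensor_add]
          abel))
    (by intro r m y; simp [btmul_smul_left, thetaTensor_smul_left])
    (by intro m r y; simp [btmul_balanced, thetaTensor_balanced])

theorem freeAct_btmul (P : Type u) [AddCommGroup P] [Module R P] (m : M)
    (y : P × BTensor R M P) :
    freeAct θ P (btmul R m y) = ((0 : P), btmul R m y.1 + thetaTensor θ P m y.2) :=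
  BTensor.lift_btmul _ _ _ _ _

variable (θ) in
/-- The functor `l = T ⊗_R -` on objects, where `T = R ⋉_θ M`:
`l(P) = (P ⊕ (M ⊗_R P), α)` with `α` the matrix with rows `(0, 0)` and `(1, θ ⊗ 1)`. -/
def l (P : Type u) [AddCommGroup P] [Module R P] : ThetaModule θ where
  carrier := P × BTensor R M P
  act := freeAct θ P
  act_act m n y := by
    simp only [freeAct_btmul, btmul_zero_right, zero_add, map_add, thetaTensor_btmul,
      thetaTensor_thetaTensor]

/-- The functor `q = R ⊗_T -` on objects: `q(X, α) = Coker(α)`. -/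
abbrev q (X : ThetaModule θ) : Type u := X.carrier ⧸ LinearMap.range X.act

section

variable {X Y : ThetaModule θ}

theorem map_smul_base (f : X.carrier →ₗ[ThetaExt θ] Y.carrier) (r : R) (x : X.carrier) :
    f (r • x) = r • f x := by
  have h := f.map_smul (⟨r, 0⟩ : ThetaExt θ) x
  rw [smul_def, smul_def] at h
  simpa only [btmul_zero_left, map_zero, add_zero] using h

theorem map_act (f : X.carrier →ₗ[ThetaExt θ] Y.carrier) (m : M) (x : X.carrier) :
    f (X.act (btmul R m x)) = Y.act (btmul R m (f x)) := by
  have h := f.map_smul (⟨0, m⟩ : ThetaExt θ) x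
  rw [smul_def, smul_def] at h
  simpa only [zero_smul, zero_add] using h

/-- The functor `e` on morphisms: the `R`-linear map that underlies a `T`-linear map. -/
def restrict (f : X.carrier →ₗ[ThetaExt θ] Y.carrier) : X.carrier →ₗ[R] Y.carrier where
  toFun := f
  map_add' := f.map_add
  map_smul' := map_smul_base f

theorem range_act_le (f : X.carrier →ₗ[ThetaExt θ] Y.carrier) :
    LinearMap.range X.act ≤ (LinearMap.range Y.act).comap (restrict f) := by
  rintro _ ⟨t, rfl⟩
  induction t using BTensor.induction with
  | zero => simp
  | tmul m x => exact ⟨_, (map_act f m x).symm⟩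
  | add s t hs ht => rw [map_add]; exact Submodule.add_mem _ hs ht

/-- The functor `q = R ⊗_T -` on morphisms: the map that `f` induces on the cokernels. -/
def qMap (f : X.carrier →ₗ[ThetaExt θ] Y.carrier) : q X →ₗ[R] q Y :=
  Submodule.mapQ _ _ (restrict f) (range_act_le f)

end

end ThetaModule

end

/-! Restriction along `T → R`, that is `L ↦ (L, 0)` (`triv`), is right adjoint to `q`: a `T`-map
from `X` to `(L, 0)` kills the image of the structure map, so it is the same as an `R`-map from `q
X` to `L`. Transposing, `𝒟_{q(δ)}` and `Gen(Coker α)` are the preimages under `triv` of `𝒟_δ` and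
`Gen(X, α)` (`classD_qMap_iff`, `classGen_q_iff`). So the equality that defines silting pulls back.
For partial silting, `triv` is exact and compatible with coproducts, so torsion classes pull back
too (`isTorsionClass_comap_triv`); `Coker α` lies in the preimage because `(Coker α, 0)` is a
quotient of `(X, α)`. The presentation survives because `q` is right exact and preserves
projectives. -/

namespace ThetaModule

section

variable {R : Type u} [Ring R]
variable {M : Type u} [AddCommGroup M] [Module R M] [Module Rᵐᵒᵖ M] [SMulCommClass R Rᵐᵒᵖ M]

/-! ### Restriction along `T → R` and its adjunction with `q` -/

/-- The functor `Mod R → Mod T` on objects, given by restriction along `T → R`: the pair `(L, 0)`. -/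
def triv (θ : AssocBimoduleHom R M) (L : Type u) [AddCommGroup L] [Module R L] :
    ThetaModule θ where
  carrier := L
  act := 0
  act_act _ _ _ := rfl

variable {θ : AssocBimoduleHom R M}
variable {A B L : Type u} [AddCommGroup A] [Module R A] [AddCommGroup B] [Module R B]
  [AddCommGroup L] [Module R L]
variable {X Y Z : ThetaModule θ}

theorem triv_smul (a : ThetaExt θ) (x : (triv θ L).carrier) :
    a • x = a.fst • x :=
  -- The structure map is zero, so the action unfolds to `a.fst • x + 0`.
  add_zero (a.fst • x)

/-- The functor `Mod R → Mod T` on morphisms. -/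
def trivMap (θ : AssocBimoduleHom R M) (g : A →ₗ[R] B) :
    (triv θ A).carrier →ₗ[ThetaExt θ] (triv θ B).carrier where
  toFun := g
  map_add' := g.map_add
  map_smul' a x := by
    exact (congrArg g (triv_smul a x)).trans <|
      (g.map_smul a.fst x).trans (triv_smul (L := B) a (g x)).symm

/-- The unit `X → (Coker α, 0)` of the adjunction between `q` and restriction along `T → R`. -/
def toTrivQ (X : ThetaModule θ) : X.carrier →ₗ[ThetaExt θ] (triv θ (q X)).carrier where
  toFun := Submodule.mkQ (LinearMap.range X.act)
  map_add' := map_add _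
  map_smul' a x := by
    refine Eq.trans ?_ (triv_smul (L := q X) a (Submodule.Quotient.mk x)).symm
    -- `(r, m) x - r x = α(m ⊗ x)` vanishes in the cokernel.
    exact (Submodule.Quotient.eq _).2 <| by
      rw [smul_def, add_sub_cancel_left]
      exact LinearMap.mem_range_self _ _

theorem toTrivQ_surjective (X : ThetaModule θ) : Function.Surjective (toTrivQ X) :=
  Submodule.mkQ_surjective (LinearMap.range X.act)

/-- A `T`-linear map `X → (L, 0)` factors through `Coker α`. -/
def descend (f : X.carrier →ₗ[ThetaExt θ] (triv θ L).carrier) : q X →ₗ[R] L :=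
  (LinearMap.range X.act).liftQ (show X.carrier →ₗ[R] L from restrict f) <| by
    rintro _ ⟨t, rfl⟩
    -- `f` sends `α(t)` into the range of the structure map of `(L, 0)`, which is zero.
    obtain ⟨s, hs⟩ := range_act_le f ⟨t, rfl⟩
    exact hs.symm

theorem descend_mk (f : X.carrier →ₗ[ThetaExt θ] (triv θ L).carrier) (x : X.carrier) :
    descend f (Submodule.Quotient.mk x) = f x := rfl

theorem descend_surjective {f : X.carrier →ₗ[ThetaExt θ] (triv θ L).carrier}
    (hf : Function.Surjective f) : Function.Surjective (descend f) := fun y =>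
  (hf y).imp' Submodule.Quotient.mk fun x hx => (descend_mk f x).trans hx

/-! ### Right exactness of `q` and preservation of projectives -/

theorem qMap_mk (f : X.carrier →ₗ[ThetaExt θ] Y.carrier) (x : X.carrier) :
    qMap f (Submodule.Quotient.mk x) = Submodule.Quotient.mk (f x) := rfl

theorem qMap_surjective {f : X.carrier →ₗ[ThetaExt θ] Y.carrier}
    (hf : Function.Surjective f) : Function.Surjective (qMap f) := by
  intro y
  obtain ⟨y, rfl⟩ := Submodule.Quotient.mk_surjective _ y
  obtain ⟨x, rfl⟩ := hf y
  exact ⟨Submodule.Quotient.mk x, qMap_mk f x⟩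

/-- Each generator `m ⊗ y` lifts to some `m ⊗ x`, and `f` commutes with the structure maps. This is
what lets relations in a cokernel be lifted in `qMap_exact`. -/
theorem range_act_le_map {f : X.carrier →ₗ[ThetaExt θ] Y.carrier}
    (hf : Function.Surjective f) :
    LinearMap.range Y.act ≤ (LinearMap.range X.act).map (restrict f) := by
  rintro _ ⟨t, rfl⟩
  induction t using BTensor.induction with
  | zero => simp
  | tmul m y =>
    obtain ⟨x, rfl⟩ := hf y
    exact ⟨_, ⟨_, rfl⟩, map_act f m x⟩
  | add s t hs ht => rw [map_add]; exact Submodule.add_mem _ hs ht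

/-- The functor `q` is right exact. -/
theorem qMap_exact {f : X.carrier →ₗ[ThetaExt θ] Y.carrier}
    {g : Y.carrier →ₗ[ThetaExt θ] Z.carrier} (hfg : Function.Exact f g)
    (hg : Function.Surjective g) : Function.Exact (qMap f) (qMap g) := by
  intro y
  obtain ⟨y, rfl⟩ := Submodule.Quotient.mk_surjective _ y
  constructor
  · intro h
    rw [qMap_mk, Submodule.Quotient.mk_eq_zero] at h
    -- Correct `y` by an element `w` that dies in `q Y`, so that `y - w` lies in the kernel of `g`.
    obtain ⟨w, hw, hwy⟩ := range_act_le_map hg h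
    obtain ⟨x, hx⟩ := (hfg (y - w)).1 (by rw [map_sub, sub_eq_zero]; exact hwy.symm)
    refine ⟨Submodule.Quotient.mk x, ?_⟩
    rw [qMap_mk, hx, Submodule.Quotient.eq, sub_sub_cancel_left]
    exact Submodule.neg_mem _ hw
  · rintro ⟨x, hx⟩
    obtain ⟨x, rfl⟩ := Submodule.Quotient.mk_surjective _ x
    rw [← hx, qMap_mk, qMap_mk, hfg.apply_apply_eq_zero, Submodule.Quotient.mk_zero]

/-- The functor `q` preserves projectives. -/
theorem projective_q (h : Module.Projective (ThetaExt θ) X.carrier) :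
    Module.Projective R (q X) := by
  refine Module.Projective.of_lifting_property'' fun g hg => ?_
  -- Lift the unit `X → (Coker α, 0)` through `g`, still surjective as a `T`-map; the transpose of
  -- the lift is a section of `g`.
  obtain ⟨s, hs⟩ := Module.projective_lifting_property (trivMap θ g) (toTrivQ X) hg
  refine ⟨descend s, LinearMap.ext fun x => ?_⟩
  obtain ⟨x, rfl⟩ := Submodule.Quotient.mk_surjective _ x
  exact LinearMap.congr_fun hs x

theorem isProjectivePresentation_qMap {δ : X.carrier →ₗ[ThetaExt θ] Y.carrier}
    {π : Y.carrier →ₗ[ThetaExt θ] Z.carrier} (h : Silting.IsProjectivePresentation δ π) :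
    Silting.IsProjectivePresentation (qMap δ) (qMap π) where
  projective₁ := projective_q h.projective₁
  projective₀ := projective_q h.projective₀
  exact := qMap_exact h.exact h.surjective
  surjective := qMap_surjective h.surjective

/-! ### The classes `𝒟` and `Gen` as preimages -/

/-- By adjunction, `L` lies in `𝒟_{q(δ)}` if and only if `(L, 0)` lies in `𝒟_δ`. -/
theorem classD_qMap_iff (δ : X.carrier →ₗ[ThetaExt θ] Y.carrier) (L : ModuleCat.{u} R) :
    Silting.classD (qMap δ) L ↔
      Silting.classD δ (ModuleCat.of (ThetaExt θ) (triv θ L).carrier) := by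
  constructor
  · intro h f
    obtain ⟨g, hg⟩ := h (descend (L := L) f)
    exact ⟨trivMap θ g ∘ₗ toTrivQ Y,
      LinearMap.ext fun x => LinearMap.congr_fun hg (Submodule.Quotient.mk x)⟩
  · intro h f
    obtain ⟨g, hg⟩ := h (trivMap θ f ∘ₗ toTrivQ X)
    refine ⟨descend (L := L) g, LinearMap.ext fun x => ?_⟩
    obtain ⟨x, rfl⟩ := Submodule.Quotient.mk_surjective _ x
    exact LinearMap.congr_fun hg x

/-- By adjunction, `L` lies in `Gen(Coker α)` if and only if `(L, 0)` lies in `Gen(X, α)`. -/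
theorem classGen_q_iff (X : ThetaModule θ) (L : ModuleCat.{u} R) :
    Silting.classGen R (q X) L ↔ Silting.classGen (ThetaExt θ) X.carrier
      (ModuleCat.of (ThetaExt θ) (triv θ L).carrier) := by
  constructor
  · rintro ⟨J, f, hf⟩
    -- Transpose each component of `f`, keeping the index set `J`. The scalars `ℕ` in `lsum` commute
    -- with the action of the noncommutative ring.
    let F : (J →₀ X.carrier) →ₗ[ThetaExt θ] (triv θ L).carrier :=
      Finsupp.lsum ℕ fun j => trivMap θ (f ∘ₗ Finsupp.lsingle j) ∘ₗ toTrivQ X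
    refine ⟨J, F, fun y => ?_⟩
    obtain ⟨w, rfl⟩ := hf y
    -- `F` takes `single j x` to `f (single j [x])`, and such values generate the image of `f`.
    induction w using Finsupp.induction_linear with
    | zero => exact ⟨0, by rw [map_zero, map_zero]; rfl⟩
    | add v w hv hw =>
      obtain ⟨v', hv⟩ := hv
      obtain ⟨w', hw⟩ := hw
      refine ⟨v' + w', ?_⟩
      rw [map_add, map_add, hv, hw]
      rfl
    | single j x =>
      obtain ⟨x, rfl⟩ := Submodule.Quotient.mk_surjective _ x
      exact ⟨Finsupp.single j x, Finsupp.lsum_single _ _ _ _⟩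
  · rintro ⟨J, f, hf⟩
    let F : (J →₀ q X) →ₗ[R] L :=
      Finsupp.lsum ℕ fun j => descend (L := L) (f ∘ₗ Finsupp.lsingle j)
    refine ⟨J, F, fun y => ?_⟩
    obtain ⟨w, rfl⟩ := hf y
    induction w using Finsupp.induction_linear with
    | zero => exact ⟨0, by rw [map_zero, map_zero]; rfl⟩
    | add v w hv hw =>
      obtain ⟨v', hv⟩ := hv
      obtain ⟨w', hw⟩ := hw
      refine ⟨v' + w', ?_⟩
      rw [map_add, map_add, hv, hw]
      rfl
    | single j x =>
      exact ⟨Finsupp.single j (Submodule.Quotient.mk x), Finsupp.lsum_single _ _ _ _⟩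

/-! ### Pulling back torsion classes -/

/-- The canonical map from the coproduct of the `(Y j, 0)` to `(⨁ j, Y j, 0)`. -/
noncomputable def directSumTriv (θ : AssocBimoduleHom R M) (J : Type u) (Y : J → ModuleCat.{u} R) :
    (DirectSum J fun j => (triv θ (Y j)).carrier) →ₗ[ThetaExt θ]
      (triv θ (DirectSum J fun j => Y j)).carrier := by
  classical
  exact DirectSum.toModule (ThetaExt θ) J _ fun j =>
    trivMap θ (DirectSum.lof R J (fun j => Y j) j)

/-- Surjectivity suffices, since torsion classes are closed under epimorphic images. -/
theorem directSumTriv_surjective (J : Type u) (Y : J → ModuleCat.{u} R) :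
    Function.Surjective (directSumTriv θ J Y) := by
  classical
  intro (y : DirectSum J fun j => Y j)
  induction y using DirectSum.induction_on with
  | zero => exact ⟨0, map_zero _⟩
  | of j y => exact ⟨DirectSum.lof (ThetaExt θ) J (fun j => (triv θ (Y j)).carrier) j y,
      DirectSum.toModule_lof _ _ _⟩
  | add v w hv hw =>
    obtain ⟨v', hv⟩ := hv
    obtain ⟨w', hw⟩ := hw
    refine ⟨v' + w', ?_⟩
    rw [map_add, hv, hw]
    rfl

/-- The preimage of a torsion class under restriction along `T → R` is a torsion class. -/
theorem isTorsionClass_comap_triv {C : ModuleCat.{u} (ThetaExt θ) → Prop}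
    (h : Silting.IsTorsionClass C) :
    Silting.IsTorsionClass fun L : ModuleCat.{u} R =>
      C (ModuleCat.of (ThetaExt θ) (triv θ L).carrier) where
  -- `trivMap` keeps the underlying function, so injectivity, exactness and surjectivity carry over
  -- verbatim.
  of_surjective _ _ f hf hA := h.of_surjective _ _ (trivMap θ f) hf hA
  of_extension _ _ _ f g hf hfg hg hA hB :=
    h.of_extension _ _ _ (trivMap θ f) (trivMap θ g) hf hfg hg hA hB
  of_coproduct J Y hY := h.of_surjective _ _ (directSumTriv θ J Y)
    (directSumTriv_surjective J Y)
    (h.of_coproduct J (fun j => ModuleCat.of (ThetaExt θ) (triv θ (Y j)).carrier) hY)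

/-! ### Silting and partial silting descend along `q` -/

theorem isSilting_qMap {δ : X.carrier →ₗ[ThetaExt θ] Y.carrier}
    (h : Silting.IsSilting Z.carrier δ) : Silting.IsSilting (q Z) (qMap δ) where
  presentation := h.presentation.imp' qMap fun _ => isProjectivePresentation_qMap
  gen_eq := by
    funext L
    rw [eq_iff_iff, classGen_q_iff, classD_qMap_iff, h.gen_eq]

theorem isPartialSilting_qMap {δ : X.carrier →ₗ[ThetaExt θ] Y.carrier}
    (h : Silting.IsPartialSilting Z.carrier δ) :
    Silting.IsPartialSilting (q Z) (qMap δ) where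
  presentation := h.presentation.imp' qMap fun _ => isProjectivePresentation_qMap
  mem := (classD_qMap_iff δ _).2
    -- The unit exhibits `(q Z, 0)` as a quotient of `Z`, which lies in the torsion class `𝒟_δ`.
    (h.torsion.of_surjective _ _ (toTrivQ Z) (toTrivQ_surjective Z) h.mem)
  torsion := by
    have hD : Silting.classD (qMap δ) = fun L : ModuleCat.{u} R =>
        Silting.classD δ (ModuleCat.of (ThetaExt θ) (triv θ L).carrier) :=
      funext fun L => propext (classD_qMap_iff δ L)
    rw [hD]
    exact isTorsionClass_comap_triv h.torsion

end

end ThetaModule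

theorem proposition4p3 {R : Type u} [Ring R] {M : Type u} [AddCommGroup M] [Module R M]
    [Module Rᵐᵒᵖ M] [SMulCommClass R Rᵐᵒᵖ M] (θ : AssocBimoduleHom R M)
    {P₁ P₀ : Type u} [AddCommGroup P₁] [Module R P₁] [AddCommGroup P₀] [Module R P₀]
    (X : ThetaModule θ)
    (δ : (ThetaModule.l θ P₁).carrier →ₗ[ThetaExt θ] (ThetaModule.l θ P₀).carrier)
    (π : (ThetaModule.l θ P₀).carrier →ₗ[ThetaExt θ] X.carrier)
    (hδ : Silting.IsProjectivePresentation δ π) :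
    (Silting.IsSilting X.carrier δ →
      Silting.IsSilting (ThetaModule.q X) (ThetaModule.qMap δ)) ∧
    (Silting.IsPartialSilting X.carrier δ →
      Silting.IsPartialSilting (ThetaModule.q X) (ThetaModule.qMap δ)) :=
  ⟨ThetaModule.isSilting_qMap, ThetaModule.isPartialSilting_qMap⟩
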